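/- Let $E$ be an elliptic curve over $\mathbb{Q}$ and let $p$ be a prime at which $E$ has good ordinary reduction; that is, $E$ has good reduction at $p$ and $p\nmid a_p$, where $a_p=p+1-\#E(\mathbb{F}_p)$. Let $\theta\in[0,\pi]$ be the Frobenius angle of $E$ at $p$, that is, the angle such that the roots of $T^2-a_pT+p$ are $\sqrt p\,e^{i\theta}$ and $\sqrt p\,e^{-i\theta}$. Let $J_0(z)=\sum_{m\ge 0}\frac{(-1)^m}{(m!)^2}\left(\frac z2\right)^{2m}$ be the Bessel function of the first kind of order $0$. Then for every integer $k\neq 0$, as the real number $x\to\infty$, $$\sum_{1\le n\le x}e^{-2\pi i k\cos(n\theta)}=J_0(2\pi k)\,x+o(x).$$ -/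

import Mathlib

open Polynomial

noncomputable section

namespace FrobeniusAngle

/-- The Bessel function of the first kind of order zero,
`J₀(z) = ∑_{m ≥ 0} (-1)^m / (m!)^2 * (z / 2)^(2m)`. -/
def besselJZero (z : ℂ) : ℂ :=
  ∑' m : ℕ, (-1) ^ m / (m.factorial : ℂ) ^ 2 * (z / 2) ^ (2 * m)

/-- The series defining `J₀` converges absolutely at every point. -/
theorem summable_besselJZero (z : ℂ) :
    Summable fun m : ℕ => (-1) ^ m / (m.factorial : ℂ) ^ 2 * (z / 2) ^ (2 * m) := by
  refine Summable.of_norm_bounded (Real.summable_pow_div_factorial (‖z / 2‖ ^ 2)) fun m => ?_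
  have h1 : (1 : ℝ) ≤ m.factorial := by exact_mod_cast Nat.factorial_pos m
  rw [norm_mul, norm_div, norm_pow, norm_pow, norm_pow, norm_neg, norm_one, one_pow,
    Complex.norm_natCast, ← pow_mul, div_mul_eq_mul_div, one_mul]
  gcongr
  nlinarith

/-- A minimal Weierstrass equation at `p` (over the `p`-adic integers) of a curve over `ℚ`. -/
def minimalAt (E : WeierstrassCurve ℚ) (p : ℕ) [Fact p.Prime] : WeierstrassCurve ℚ_[p] :=
  (E.baseChange ℚ_[p]).minimal ℤ_[p]

instance (E : WeierstrassCurve ℚ) (p : ℕ) [Fact p.Prime] :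
    WeierstrassCurve.IsMinimal ℤ_[p] (minimalAt E p) :=
  inferInstanceAs (WeierstrassCurve.IsMinimal ℤ_[p] ((E.baseChange ℚ_[p]).minimal ℤ_[p]))

/-- `p` is a prime of good reduction of `E`. -/
def HasGoodReductionAt (E : WeierstrassCurve ℚ) (p : ℕ) [Fact p.Prime] : Prop :=
  (minimalAt E p).HasGoodReduction ℤ_[p]

/-- The reduction of `E` modulo `p`, a curve over the residue field `ℤ_p / pℤ_p = 𝔽_p`. -/
def reductionAt (E : WeierstrassCurve ℚ) (p : ℕ) [Fact p.Prime] :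
    WeierstrassCurve (IsLocalRing.ResidueField ℤ_[p]) :=
  (minimalAt E p).reduction ℤ_[p]

/-- The trace of Frobenius `a_p = p + 1 - #E(𝔽_p)`; the point at infinity is counted. -/
def frobeniusTrace (E : WeierstrassCurve ℚ) (p : ℕ) [Fact p.Prime] : ℤ :=
  p + 1 - Nat.card (reductionAt E p).toAffine.Point

/-- `E` has good ordinary reduction at `p`: good reduction, and `p ∤ a_p`. -/
def IsOrdinaryAt (E : WeierstrassCurve ℚ) (p : ℕ) [Fact p.Prime] : Prop :=
  HasGoodReductionAt E p ∧ ¬ (p : ℤ) ∣ frobeniusTrace E p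

/-- `θ ∈ [0, π]` is the Frobenius angle of `E` at `p`: the two roots, with multiplicity, of the
characteristic polynomial `T^2 - a_p T + p` of Frobenius are `√p e^{iθ}` and `√p e^{-iθ}`. -/
def IsFrobeniusAngle (E : WeierstrassCurve ℚ) (p : ℕ) [Fact p.Prime] (θ : ℝ) : Prop :=
  θ ∈ Set.Icc 0 Real.pi ∧
    (X ^ 2 - C (frobeniusTrace E p : ℂ) * X + C (p : ℂ) : ℂ[X]).roots =
      {(Real.sqrt p : ℂ) * Complex.exp (θ * Complex.I),
        (Real.sqrt p : ℂ) * Complex.exp (-θ * Complex.I)}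

end FrobeniusAngle

end

open Filter Topology

namespace FrobeniusAngle

/-! Ordinarity forces `w = exp (iθ)` not to be a root of unity (`exp_angle_zpow_ne_one`). Hence in
the expansion of `cos (nθ) ^ m` into powers of `w ^ n`, every nonconstant mode averages to zero,
leaving the mean of `cos ^ m` over a period (`tendsto_average_cos_pow`). Expanding the exponential
and exchanging limit and series by dominated convergence gives a series in these moments, which is
that of `J₀`. Moments thus replace an appeal to Weyl equidistribution. -/

/-- A root of unity and its inverse are algebraic integers, so `(w + w⁻¹) ^ 2 = a ^ 2 / p` would be
a rational integer, forcing `p ∣ a`. -/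
theorem pow_ne_one_of_quadratic {p : ℕ} (hp : p.Prime) {a : ℤ} (ha : ¬ (p : ℤ) ∣ a) {w : ℂ}
    (hw : (p : ℂ) * (w ^ 2 + 1) ^ 2 = a ^ 2 * w ^ 2) {j : ℕ} (hj : 0 < j) : w ^ j ≠ 1 := by
  intro h
  have hw0 : w ≠ 0 := by
    rintro rfl
    simp [hj.ne'] at h
  have hint : IsIntegral ℤ w := by
    refine IsIntegral.of_pow hj ?_
    rw [h]
    exact isIntegral_one
  have hint' : IsIntegral ℤ w⁻¹ := by
    refine IsIntegral.of_pow hj ?_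
    rw [inv_pow, h, inv_one]
    exact isIntegral_one
  have hp0 : (p : ℂ) ≠ 0 := Nat.cast_ne_zero.mpr hp.ne_zero
  have hp0' : (p : ℚ) ≠ 0 := Nat.cast_ne_zero.mpr hp.ne_zero
  have hq : IsIntegral ℤ (algebraMap ℚ ℂ ((a : ℚ) ^ 2 / p)) := by
    have e : algebraMap ℚ ℂ ((a : ℚ) ^ 2 / p) = (w + w⁻¹) ^ 2 := by
      simp only [eq_ratCast]
      push_cast
      field_simp
      linear_combination -hw
    rw [e]
    exact (hint.add hint').pow 2
  rw [isIntegral_algebraMap_iff (algebraMap ℚ ℂ).injective] at hq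
  obtain ⟨b, hb⟩ := IsIntegrallyClosed.isIntegral_iff.mp hq
  have hb' : (b : ℚ) * p = a ^ 2 := by
    rw [← eq_div_iff hp0']
    simpa using hb
  have hb'' : b * p = a ^ 2 := by exact_mod_cast hb'
  exact ha ((Nat.prime_iff_prime_int.mp hp).dvd_of_dvd_pow ⟨b, by rw [← hb'', mul_comm]⟩)

theorem exp_angle_zpow_ne_one {E : WeierstrassCurve ℚ} {p : ℕ} [Fact p.Prime] (hord : IsOrdinaryAt E p)
    {θ : ℝ} (hθ : IsFrobeniusAngle E p θ) {j : ℤ} (hj : j ≠ 0) :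
    Complex.exp (θ * Complex.I) ^ j ≠ 1 := by
  have hp : p.Prime := Fact.out
  set w := Complex.exp (θ * Complex.I)
  have hroot : (Real.sqrt p : ℂ) * w ∈
      (X ^ 2 - C (frobeniusTrace E p : ℂ) * X + C (p : ℂ) : ℂ[X]).roots := by
    rw [hθ.2]
    simp [w]
  have h := (mem_roots'.mp hroot).2
  simp only [IsRoot.def, eval_add, eval_sub, eval_mul, eval_pow, eval_X, eval_C] at h
  have hs : (Real.sqrt p : ℂ) ^ 2 = p := by
    rw [← Complex.ofReal_pow, Real.sq_sqrt p.cast_nonneg, Complex.ofReal_natCast]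
  have hp0 : (p : ℂ) ≠ 0 := Nat.cast_ne_zero.mpr hp.ne_zero
  -- Squaring the root equation eliminates `√p`.
  have hw : (p : ℂ) * (w ^ 2 + 1) ^ 2 = (frobeniusTrace E p : ℂ) ^ 2 * w ^ 2 := by
    apply mul_left_cancel₀ hp0
    have h1 : (p : ℂ) * (w ^ 2 + 1) = frobeniusTrace E p * (Real.sqrt p * w) := by
      linear_combination h - w ^ 2 * hs
    calc (p : ℂ) * (p * (w ^ 2 + 1) ^ 2) = (p * (w ^ 2 + 1)) ^ 2 := by ring
      _ = (Real.sqrt p : ℂ) ^ 2 * (frobeniusTrace E p ^ 2 * w ^ 2) := by rw [h1]; ring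
      _ = _ := by rw [hs]
  have key := pow_ne_one_of_quadratic hp hord.2 hw (Int.natAbs_pos.mpr hj)
  intro hwj
  apply key
  rcases Int.natAbs_eq j with e | e <;> rw [e] at hwj
  · rwa [zpow_natCast] at hwj
  · rwa [zpow_neg, zpow_natCast, inv_eq_one] at hwj

/-- The geometric sums stay bounded by `2 / ‖w - 1‖`. -/
theorem tendsto_average_pow_zero {w : ℂ} (hw : ‖w‖ = 1) (hw1 : w ≠ 1) :
    Tendsto (fun N : ℕ => (∑ n ∈ Finset.Icc 1 N, w ^ n) / (N : ℂ)) atTop (𝓝 0) := by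
  have hpos : 0 < ‖w - 1‖ := norm_pos_iff.mpr (sub_ne_zero.mpr hw1)
  refine squeeze_zero_norm (fun N => ?_) (tendsto_const_div_atTop_nhds_zero_nat (2 / ‖w - 1‖))
  rw [norm_div, Complex.norm_natCast]
  gcongr
  rw [← Finset.Ico_add_one_right_eq_Icc, geom_sum_Ico hw1 (by omega), norm_div]
  gcongr
  refine (norm_sub_le _ _).trans ?_
  simp only [norm_pow, hw, one_pow]
  norm_num

/-- The mean value of `cos ^ m` over a period. -/
noncomputable def cosPowMean (m : ℕ) : ℂ :=
  ∑ j ∈ Finset.range (m + 1), if 2 * j = m then (m.choose j : ℂ) / 2 ^ m else 0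

theorem cosPowMean_two_mul (j : ℕ) : cosPowMean (2 * j) = ((2 * j).choose j : ℂ) / 2 ^ (2 * j) := by
  rw [cosPowMean, Finset.sum_eq_single j]
  · simp
  · intro b _ hb
    rw [if_neg (by omega)]
  · intro h
    exact absurd (Finset.mem_range.mpr (by omega)) h

theorem cosPowMean_of_odd {m : ℕ} (hm : Odd m) : cosPowMean m = 0 := by
  obtain ⟨r, rfl⟩ := hm
  exact Finset.sum_eq_zero fun j _ => if_neg (by omega)

theorem cos_pow_eq_sum (θ : ℝ) (m n : ℕ) :
    (Real.cos (n * θ) : ℂ) ^ m = ∑ j ∈ Finset.range (m + 1),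
      (m.choose j : ℂ) / 2 ^ m * (Complex.exp (θ * Complex.I) ^ (2 * j - m : ℤ)) ^ n := by
  have h : (Real.cos (n * θ) : ℂ) =
      (Complex.exp (n * θ * Complex.I) + Complex.exp (-(n * θ * Complex.I))) / 2 := by
    rw [Complex.ofReal_cos, Complex.cos]
    push_cast
    rw [neg_mul]
  rw [h, div_pow, add_pow, Finset.sum_div]
  refine Finset.sum_congr rfl fun j hj => ?_
  have hjm : j ≤ m := Nat.lt_succ_iff.mp (Finset.mem_range.mp hj)
  have e : Complex.exp (n * θ * Complex.I) ^ j * Complex.exp (-(n * θ * Complex.I)) ^ (m - j) =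
      (Complex.exp (θ * Complex.I) ^ (2 * j - m : ℤ)) ^ n := by
    rw [← Complex.exp_nat_mul, ← Complex.exp_nat_mul, ← Complex.exp_int_mul, ← Complex.exp_nat_mul,
      ← Complex.exp_add]
    congr 1
    push_cast [hjm]
    ring
  rw [e]
  ring

theorem tendsto_average_cos_pow {θ : ℝ}
    (hθ : ∀ j : ℤ, j ≠ 0 → Complex.exp (θ * Complex.I) ^ j ≠ 1) (m : ℕ) :
    Tendsto (fun N : ℕ => (∑ n ∈ Finset.Icc 1 N, (Real.cos (n * θ) : ℂ) ^ m) / (N : ℂ)) atTop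
      (𝓝 (cosPowMean m)) := by
  have e : (fun N : ℕ => (∑ n ∈ Finset.Icc 1 N, (Real.cos (n * θ) : ℂ) ^ m) / (N : ℂ)) =
      fun N : ℕ => ∑ j ∈ Finset.range (m + 1), (m.choose j : ℂ) / 2 ^ m *
        ((∑ n ∈ Finset.Icc 1 N, (Complex.exp (θ * Complex.I) ^ (2 * j - m : ℤ)) ^ n) / (N : ℂ)) := by
    funext N
    simp_rw [cos_pow_eq_sum]
    rw [Finset.sum_comm, Finset.sum_div]
    refine Finset.sum_congr rfl fun j _ => ?_
    rw [← Finset.mul_sum, mul_div_assoc]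
  rw [e]
  -- The sum in `cosPowMean` matches the modes term by term; only `2 * j = m` is constant in `n`.
  refine tendsto_finsetSum _ fun j _ => ?_
  split_ifs with hj
  · have h1 : (2 * j - m : ℤ) = 0 := by omega
    rw [h1]
    refine tendsto_const_nhds.congr' ?_
    filter_upwards [eventually_gt_atTop 0] with N hN
    have : (N : ℂ) ≠ 0 := Nat.cast_ne_zero.mpr hN.ne'
    simp [this]
  · have h1 : (2 * j - m : ℤ) ≠ 0 := by omega
    have := (tendsto_average_pow_zero (w := Complex.exp (θ * Complex.I) ^ (2 * j - m : ℤ))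
      (by rw [norm_zpow, Complex.norm_exp_ofReal_mul_I, one_zpow]) (hθ _ h1)).const_mul
        ((m.choose j : ℂ) / 2 ^ m)
    rwa [mul_zero] at this

/-- Odd moments vanish, and `(2j).choose j / (2j)! = 1 / (j!) ^ 2`. -/
theorem tsum_pow_div_factorial_mul_cosPowMean (z : ℂ) :
    ∑' m : ℕ, (-(Complex.I * z)) ^ m / (m.factorial : ℂ) * cosPowMean m = besselJZero z := by
  have hinj : Function.Injective fun j : ℕ => 2 * j := fun a b h => by simpa using h
  rw [← hinj.tsum_eq, besselJZero]
  · refine tsum_congr fun j => ?_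
    rw [cosPowMean_two_mul, Nat.cast_choose ℂ (by omega : j ≤ 2 * j),
      show 2 * j - j = j by omega, neg_pow, pow_mul (-1 : ℂ), mul_pow, pow_mul Complex.I,
      Complex.I_sq, div_pow]
    have h1 : ((2 * j).factorial : ℂ) ≠ 0 := Nat.cast_ne_zero.mpr (Nat.factorial_ne_zero _)
    have h2 : (j.factorial : ℂ) ≠ 0 := Nat.cast_ne_zero.mpr (Nat.factorial_ne_zero _)
    field_simp
    norm_num
  · intro m hm
    rcases Nat.even_or_odd' m with ⟨r, rfl | rfl⟩
    · exact ⟨r, rfl⟩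
    · simp [cosPowMean_of_odd (odd_two_mul_add_one r)] at hm

theorem tendsto_average_exp_cos {θ : ℝ}
    (hθ : ∀ j : ℤ, j ≠ 0 → Complex.exp (θ * Complex.I) ^ j ≠ 1) (z : ℂ) :
    Tendsto (fun N : ℕ => (∑ n ∈ Finset.Icc 1 N,
      Complex.exp (-(Complex.I * z * Real.cos (n * θ)))) / (N : ℂ)) atTop (𝓝 (besselJZero z)) := by
  have hexp (u : ℂ) : HasSum (fun m : ℕ => u ^ m / (m.factorial : ℂ)) (Complex.exp u) := by
    rw [Complex.exp_eq_exp_ℂ]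
    exact NormedSpace.expSeries_div_hasSum_exp u
  have e : (fun N : ℕ => (∑ n ∈ Finset.Icc 1 N,
      Complex.exp (-(Complex.I * z * Real.cos (n * θ)))) / (N : ℂ)) = fun N : ℕ =>
      ∑' m : ℕ, (-(Complex.I * z)) ^ m / (m.factorial : ℂ) *
        ((∑ n ∈ Finset.Icc 1 N, (Real.cos (n * θ) : ℂ) ^ m) / (N : ℂ)) := by
    funext N
    have h := (hasSum_sum (s := Finset.Icc 1 N) fun n _ =>
      hexp (-(Complex.I * z * Real.cos (n * θ)))).div_const (N : ℂ)
    rw [← h.tsum_eq]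
    refine tsum_congr fun m => ?_
    rw [← mul_div_assoc, Finset.mul_sum]
    congr 1
    refine Finset.sum_congr rfl fun n _ => ?_
    rw [← neg_mul, mul_pow]
    ring
  rw [e, ← tsum_pow_div_factorial_mul_cosPowMean]
  -- Averages of `cos ^ m` have norm at most 1, so `‖z‖ ^ m / m!` dominates uniformly in `N`.
  refine tendsto_tsum_of_dominated_convergence (Real.summable_pow_div_factorial ‖z‖)
    (fun m => (tendsto_average_cos_pow hθ m).const_mul _) (Eventually.of_forall fun N m => ?_)
  have h1 : ‖(∑ n ∈ Finset.Icc 1 N, (Real.cos (n * θ) : ℂ) ^ m) / (N : ℂ)‖ ≤ 1 := by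
    rw [norm_div, Complex.norm_natCast]
    refine div_le_one_of_le₀ ?_ N.cast_nonneg
    refine (norm_sum_le_of_le _ (f := fun n : ℕ => (Real.cos (n * θ) : ℂ) ^ m)
      (n := fun _ => (1 : ℝ)) fun n _ => ?_).trans ?_
    · rw [norm_pow, Complex.norm_real]
      exact pow_le_one₀ (norm_nonneg _) (Real.abs_cos_le_one _)
    · simp
  rw [norm_mul, norm_div, norm_pow, norm_neg, norm_mul, Complex.norm_I, one_mul,
    Complex.norm_natCast]
  exact mul_le_of_le_one_right (by positivity) h1

end FrobeniusAngle

theorem corollary3p1 (E : WeierstrassCurve ℚ) [E.IsElliptic] (p : ℕ) [Fact p.Prime]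
    (hord : FrobeniusAngle.IsOrdinaryAt E p) (θ : ℝ)
    (hθ : FrobeniusAngle.IsFrobeniusAngle E p θ) (k : ℤ) (hk : k ≠ 0) :
    (fun x : ℝ =>
        (∑ n ∈ Finset.Icc 1 ⌊x⌋₊,
          Complex.exp (-(2 * Real.pi * Complex.I * k * Real.cos (n * θ)))) -
        FrobeniusAngle.besselJZero (2 * Real.pi * k) * x)
      =o[Filter.atTop] (fun x : ℝ => x) := by
  rw [← Complex.isLittleO_ofReal_right, Asymptotics.isLittleO_iff_tendsto'
    ((eventually_ne_atTop 0).mono fun x hx h => absurd (Complex.ofReal_eq_zero.mp h) hx)]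
  have h1 := (FrobeniusAngle.tendsto_average_exp_cos
    (fun j hj => FrobeniusAngle.exp_angle_zpow_ne_one hord hθ hj) (2 * Real.pi * k)).comp
      (tendsto_nat_floor_atTop (α := ℝ))
  -- `⌊x⌋₊ / x → 1` passes from averages over integers `N` to real `x`.
  have h2 : Tendsto (fun x : ℝ => ((⌊x⌋₊ / x : ℝ) : ℂ)) atTop (𝓝 ((1 : ℝ) : ℂ)) :=
    (Complex.continuous_ofReal.tendsto 1).comp (tendsto_nat_floor_div_atTop (R := ℝ))
  have h3 := (h1.mul h2).sub_const (FrobeniusAngle.besselJZero (2 * Real.pi * k))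
  rw [Complex.ofReal_one, mul_one, sub_self] at h3
  refine h3.congr' ?_
  filter_upwards [eventually_ge_atTop 1] with x hx
  have hx0 : (x : ℂ) ≠ 0 := Complex.ofReal_ne_zero.mpr (by linarith)
  have hf : ((⌊x⌋₊ : ℕ) : ℂ) ≠ 0 := Nat.cast_ne_zero.mpr (Nat.floor_pos.mpr hx).ne'
  have e : ∀ n : ℕ, -(Complex.I * (2 * Real.pi * k) * Real.cos (n * θ)) =
      -(2 * Real.pi * Complex.I * k * Real.cos (n * θ)) := fun n => by ring
  simp only [Function.comp_apply, e]
  rw [Complex.ofReal_div, Complex.ofReal_natCast, div_mul_div_cancel₀ hf, sub_div,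
    mul_div_cancel_right₀ _ hx0]
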